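/- Let $\mathcal X,\mathcal Y$ be metric spaces with Borel $\sigma$-fields $\mathcal F=\mathcal B(\mathcal X)$, $\mathcal G=\mathcal B(\mathcal Y)$, and let $\mu,\nu$ be probability measures on $\mathcal F,\mathcal G$. Let $L_1(\mu)$ (resp. $L_1(\nu)$) be the class of real-valued $\mathcal F$-measurable $\mu$-integrable (resp. $\mathcal G$-measurable $\nu$-integrable) functions, without identifying functions that agree almost surely, and write $\mu(f)=\int f\,d\mu$, $\nu(g)=\int g\,d\nu$. Let $\Gamma(\mu,\nu)$ be the set of probability measures on $\mathcal F\otimes\mathcal G$ with marginals $\mu$ and $\nu$. Let $c:\mathcal X\times\mathcal Y\to\mathbb R$ be such that - there are $f_1,f_2\in L_1(\mu)$ and $g_1,g_2\in L_1(\nu)$ with $f_1(x)+g_1(y)\le c(x,y)\le f_2(x)+g_2(y)$ for all $(x,y)$; - $x\mapsto c(x,y)$ is $\mathcal F$-measurable for each $y\in\mathcal Y$; - $y\mapsto c(x,y)$ is continuous for each $x\in\mathcal X$; and suppose that $\nu$ is separable, i.e. $\nu(B)=1$ for some separable set $B\in\mathcal G$. Then $c$ is integrable with respect to the completion $\overline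 P$ of every $P\in\Gamma(\mu,\nu)$. Moreover, putting $$\alpha(c)=\inf_{P\in\Gamma(\mu,\nu)}\int c\,d\overline P,\qquad \alpha^*(c)=\sup_{P\in\Gamma(\mu,\nu)}\int c\,d\overline P,$$ $$\beta(c)=\sup\{\mu(f)+\nu(g): f\in L_1(\mu),\ g\in L_1(\nu),\ f(x)+g(y)\le c(x,y)\ \text{for all }(x,y)\},$$ $$\beta^*(c)=\inf\{\mu(f)+\nu(g): f\in L_1(\mu),\ g\in L_1(\nu),\ f(x)+g(y)\ge c(x,y)\ \text{for all }(x,y)\},$$ the following hold: - (j) if $c$ is bounded below, then $\alpha^*(c)=\beta^*(c)$; - (jj) if $c$ is bounded above, then $\alpha(c)=\beta(c)$; - (jjj) if $c$ is bounded, then $\alpha(c)=\beta(c)$ and $\alpha^*(c)=\beta^*(c)$. -/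

import Mathlib

open MeasureTheory

namespace TransportDuality

/-- The class `L₁(Q)`: functions that are genuinely measurable and `Q`-integrable
(no identification of almost surely equal functions). -/
def IsL1 {Ω : Type*} [MeasurableSpace Ω] (Q : Measure Ω) (φ : Ω → ℝ) : Prop :=
  Measurable φ ∧ Integrable φ Q

/-- A Borel measure is separable if it gives mass one to some Borel separable set. -/
def IsSeparableMeasure {Ω : Type*} [TopologicalSpace Ω] [MeasurableSpace Ω]
    (Q : Measure Ω) : Prop :=
  ∃ A : Set Ω, MeasurableSet A ∧ TopologicalSpace.IsSeparable A ∧ Q A = 1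

variable {X Y : Type*} [MeasurableSpace X] [MeasurableSpace Y]

/-- The set `Γ(μ, ν)` of probability measures on the product sigma-field
with marginals `μ` and `ν`. -/
def couplings (μ : Measure X) (ν : Measure Y) : Set (Measure (X × Y)) :=
  {P | IsProbabilityMeasure P ∧ P.map Prod.fst = μ ∧ P.map Prod.snd = ν}

/-- `f₁ + g₁ ≤ c ≤ f₂ + g₂` for some `f₁, f₂ ∈ L₁(μ)` and `g₁, g₂ ∈ L₁(ν)`. -/
def HasIntegrableBounds (μ : Measure X) (ν : Measure Y) (c : X × Y → ℝ) : Prop :=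
  ∃ (f₁ f₂ : X → ℝ) (g₁ g₂ : Y → ℝ), IsL1 μ f₁ ∧ IsL1 μ f₂ ∧ IsL1 ν g₁ ∧ IsL1 ν g₂ ∧
    (∀ x y, f₁ x + g₁ y ≤ c (x, y)) ∧ (∀ x y, c (x, y) ≤ f₂ x + g₂ y)

/-- The values `∫ c dP` over `P ∈ Γ(μ, ν)`. Mathlib's integral only requires almost everywhere
strong measurability, so it is the integral against the completion of `P`, as needed for a cost
that is measurable only up to `P`-null sets. -/
def transportValues (μ : Measure X) (ν : Measure Y) (c : X × Y → ℝ) : Set ℝ :=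
  {r | ∃ P ∈ couplings μ ν, r = ∫ z, c z ∂P}

/-- The values `μ(f) + ν(g)` over `f ∈ L₁(μ)`, `g ∈ L₁(ν)` with `f + g ≤ c`. -/
def lowerDualValues (μ : Measure X) (ν : Measure Y) (c : X × Y → ℝ) : Set ℝ :=
  {r | ∃ (f : X → ℝ) (g : Y → ℝ), IsL1 μ f ∧ IsL1 ν g ∧ (∀ x y, f x + g y ≤ c (x, y)) ∧
    r = (∫ x, f x ∂μ) + ∫ y, g y ∂ν}

/-- The values `μ(f) + ν(g)` over `f ∈ L₁(μ)`, `g ∈ L₁(ν)` with `f + g ≥ c`. -/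
def upperDualValues (μ : Measure X) (ν : Measure Y) (c : X × Y → ℝ) : Set ℝ :=
  {r | ∃ (f : X → ℝ) (g : Y → ℝ), IsL1 μ f ∧ IsL1 ν g ∧ (∀ x y, c (x, y) ≤ f x + g y) ∧
    r = (∫ x, f x ∂μ) + ∫ y, g y ∂ν}

/-- `α(c) = inf_P ∫ c dP`. -/
noncomputable def alpha (μ : Measure X) (ν : Measure Y) (c : X × Y → ℝ) : ℝ :=
  sInf (transportValues μ ν c)

/-- `α*(c) = sup_P ∫ c dP`. -/
noncomputable def alphaStar (μ : Measure X) (ν : Measure Y) (c : X × Y → ℝ) : ℝ :=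
  sSup (transportValues μ ν c)

/-- `β(c) = sup {μ(f) + ν(g) : f + g ≤ c}`. -/
noncomputable def beta (μ : Measure X) (ν : Measure Y) (c : X × Y → ℝ) : ℝ :=
  sSup (lowerDualValues μ ν c)

/-- `β*(c) = inf {μ(f) + ν(g) : f + g ≥ c}`. -/
noncomputable def betaStar (μ : Measure X) (ν : Measure Y) (c : X × Y → ℝ) : ℝ :=
  sInf (upperDualValues μ ν c)

/-! The sets above are nonempty and bounded on the relevant sides, so that the real infima and
suprema are genuine as soon as `c` is integrable for every coupling. -/

theorem prod_mem_couplings (μ : Measure X) (ν : Measure Y) [IsProbabilityMeasure μ]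
    [IsProbabilityMeasure ν] : μ.prod ν ∈ couplings μ ν :=
  ⟨inferInstance, by simp [Measure.map_fst_prod], by simp [Measure.map_snd_prod]⟩

theorem integral_add_of_mem_couplings {μ : Measure X} {ν : Measure Y} {P : Measure (X × Y)}
    (hP : P ∈ couplings μ ν) {f : X → ℝ} {g : Y → ℝ} (hf : IsL1 μ f) (hg : IsL1 ν g) :
    Integrable (fun z : X × Y => f z.1 + g z.2) P ∧
      ∫ z, (f z.1 + g z.2) ∂P = (∫ x, f x ∂μ) + ∫ y, g y ∂ν := by
  obtain ⟨_, rfl, rfl⟩ := hP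
  have h1 : Integrable (fun z : X × Y => f z.1) P := hf.2.comp_measurable measurable_fst
  have h2 : Integrable (fun z : X × Y => g z.2) P := hg.2.comp_measurable measurable_snd
  refine ⟨h1.add h2, ?_⟩
  rw [integral_add h1 h2, integral_map measurable_fst.aemeasurable hf.1.aestronglyMeasurable,
    integral_map measurable_snd.aemeasurable hg.1.aestronglyMeasurable]

theorem values_nonempty {μ : Measure X} {ν : Measure Y} [IsProbabilityMeasure μ]
    [IsProbabilityMeasure ν] {c : X × Y → ℝ} (hc : HasIntegrableBounds μ ν c) :
    (transportValues μ ν c).Nonempty ∧ (lowerDualValues μ ν c).Nonempty ∧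
      (upperDualValues μ ν c).Nonempty := by
  obtain ⟨f₁, f₂, g₁, g₂, hf₁, hf₂, hg₁, hg₂, h₁, h₂⟩ := hc
  exact ⟨⟨_, _, prod_mem_couplings μ ν, rfl⟩, ⟨_, f₁, g₁, hf₁, hg₁, h₁, rfl⟩,
    ⟨_, f₂, g₂, hf₂, hg₂, h₂, rfl⟩⟩

theorem lowerDual_le_transport {μ : Measure X} {ν : Measure Y} {c : X × Y → ℝ}
    (hi : ∀ P ∈ couplings μ ν, Integrable c P) {r s : ℝ} (hr : r ∈ lowerDualValues μ ν c)
    (hs : s ∈ transportValues μ ν c) : r ≤ s := by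
  obtain ⟨f, g, hf, hg, h, rfl⟩ := hr
  obtain ⟨P, hP, rfl⟩ := hs
  obtain ⟨hi', he⟩ := integral_add_of_mem_couplings hP hf hg
  rw [← he]
  exact integral_mono hi' (hi P hP) fun z => h z.1 z.2

theorem transport_le_upperDual {μ : Measure X} {ν : Measure Y} {c : X × Y → ℝ}
    (hi : ∀ P ∈ couplings μ ν, Integrable c P) {r s : ℝ} (hr : r ∈ upperDualValues μ ν c)
    (hs : s ∈ transportValues μ ν c) : s ≤ r := by
  obtain ⟨f, g, hf, hg, h, rfl⟩ := hr
  obtain ⟨P, hP, rfl⟩ := hs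
  obtain ⟨hi', he⟩ := integral_add_of_mem_couplings hP hf hg
  rw [← he]
  exact integral_mono (hi P hP) hi' fun z => h z.1 z.2

end TransportDuality

/-! Weak duality is immediate, so for (j) the task is to produce upper potentials whose value
exceeds the primal supremum by at most `ε`. A shift reduces to `c ≥ 0` with nonnegative `f₂`, `g₂`;
statement (jj) is (j) for `-c`.

On `X × B`, with `B` separable of full measure, `c` is the limit of increasing finite maxima `c_n ≤
c` of multiples of rectangle indicators (`exists_rectangles`). Each `c_n` factors through finite
sets, where duality is a Hahn–Banach argument (`exists_plan_eq_matrixDual`), and a finite plan lifts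
to a coupling with a density with respect to `μ.prod ν`. Since `c_n ≤ c`, the primal value of every
`c_n` stays below that of `c`, so each `c_n` has dual potentials of controlled value.

It remains to let `n → ∞` in the potentials. After subtracting `f₂`, `g₂` and clamping to `[-K, K]`,
at small cost in the integrals, they are uniformly bounded. The admissible bounded pairs for `c_n`
form a decreasing sequence of convex sets, in which near minimisers of the `L²` norm converge almost
everywhere (`exists_ae_tendsto_of_antitone_midpoint`). The limit dominates every `c_n`, hence `c`,
off null sets; on these the bound `f₂ + g₂` on `c` permits a repair. No compactness of the set of
couplings is used. -/

namespace TransportDuality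

/-! ### Duality on finite index sets -/

section Finite

variable {ι κ : Type*} [Fintype ι] [Fintype κ]

/-- The dual value of a cost matrix `C` with respect to the weights `m` and `n`. -/
noncomputable def matrixDual (m : ι → ℝ) (n : κ → ℝ) (C : ι → κ → ℝ) : ℝ :=
  sInf {r | ∃ (u : ι → ℝ) (v : κ → ℝ), (∀ i j, C i j ≤ u i + v j) ∧
    r = ∑ i, m i * u i + ∑ j, n j * v j}

theorem sum_mul_le_of_le_add {p : ι → κ → ℝ} {m : ι → ℝ} {n : κ → ℝ} {C : ι → κ → ℝ}
    {u : ι → ℝ} {v : κ → ℝ} (hp : ∀ i j, 0 ≤ p i j) (hm : ∀ i, ∑ j, p i j = m i)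
    (hn : ∀ j, ∑ i, p i j = n j) (h : ∀ i j, C i j ≤ u i + v j) :
    ∑ i, ∑ j, p i j * C i j ≤ ∑ i, m i * u i + ∑ j, n j * v j := by
  calc ∑ i, ∑ j, p i j * C i j ≤ ∑ i, ∑ j, p i j * (u i + v j) := by
        gcongr with i _ j _
        · exact hp i j
        · exact h i j
    _ = ∑ i, ∑ j, p i j * u i + ∑ i, ∑ j, p i j * v j := by
        simp only [mul_add, Finset.sum_add_distrib]
    _ = _ := by
        rw [Finset.sum_comm (f := fun i j => p i j * v j)]
        simp only [← Finset.sum_mul, hm, hn]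

variable {m : ι → ℝ} {n : κ → ℝ}

theorem matrixDual_le (hm : ∀ i, 0 ≤ m i) (hn : ∀ j, 0 ≤ n j) (hm1 : ∑ i, m i = 1)
    (hn1 : ∑ j, n j = 1) {C : ι → κ → ℝ} {u : ι → ℝ} {v : κ → ℝ}
    (h : ∀ i j, C i j ≤ u i + v j) :
    matrixDual m n C ≤ ∑ i, m i * u i + ∑ j, n j * v j := by
  -- The value of the product plan bounds all dual values from below, so the real infimum is not a
  -- default value.
  refine csInf_le ⟨∑ i, ∑ j, m i * n j * C i j, ?_⟩ ⟨u, v, h, rfl⟩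
  rintro _ ⟨u', v', h', rfl⟩
  refine sum_mul_le_of_le_add (fun i j => mul_nonneg (hm i) (hn j)) (fun i => ?_) (fun j => ?_) h'
  · rw [← Finset.mul_sum, hn1, mul_one]
  · rw [← Finset.sum_mul, hm1, one_mul]

theorem exists_lt_matrixDual_add (C : ι → κ → ℝ) {ε : ℝ} (hε : 0 < ε) :
    ∃ (u : ι → ℝ) (v : κ → ℝ), (∀ i j, C i j ≤ u i + v j) ∧
      ∑ i, m i * u i + ∑ j, n j * v j < matrixDual m n C + ε := by
  have hne : {r | ∃ (u : ι → ℝ) (v : κ → ℝ), (∀ i j, C i j ≤ u i + v j) ∧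
      r = ∑ i, m i * u i + ∑ j, n j * v j}.Nonempty := by
    refine ⟨_, fun i => ∑ j, |C i j|, 0, fun i j => ?_, rfl⟩
    rw [Pi.zero_apply, add_zero]
    exact (le_abs_self _).trans
      (Finset.single_le_sum (f := fun j => |C i j|) (fun _ _ => abs_nonneg _) (Finset.mem_univ j))
  obtain ⟨_, ⟨u, v, h, rfl⟩, hlt⟩ := exists_lt_of_csInf_lt hne (lt_add_of_pos_right _ hε)
  exact ⟨u, v, h, hlt⟩

theorem matrixDual_add_le (hm : ∀ i, 0 ≤ m i) (hn : ∀ j, 0 ≤ n j) (hm1 : ∑ i, m i = 1)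
    (hn1 : ∑ j, n j = 1) (C D : ι → κ → ℝ) :
    matrixDual m n (C + D) ≤ matrixDual m n C + matrixDual m n D := by
  refine le_of_forall_pos_le_add fun ε hε => ?_
  obtain ⟨u, v, h, hlt⟩ := exists_lt_matrixDual_add (m := m) (n := n) C (half_pos hε)
  obtain ⟨u', v', h', hlt'⟩ := exists_lt_matrixDual_add (m := m) (n := n) D (half_pos hε)
  have := matrixDual_le hm hn hm1 hn1 (C := C + D) (u := u + u') (v := v + v') fun i j => by
    have := h i j
    have := h' i j
    simp only [Pi.add_apply]
    linarith
  simp only [Pi.add_apply, mul_add, Finset.sum_add_distrib] at this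
  linarith

theorem matrixDual_smul_le (hm : ∀ i, 0 ≤ m i) (hn : ∀ j, 0 ≤ n j) (hm1 : ∑ i, m i = 1)
    (hn1 : ∑ j, n j = 1) {a : ℝ} (ha : 0 < a) (C : ι → κ → ℝ) :
    matrixDual m n (a • C) ≤ a * matrixDual m n C := by
  refine le_of_forall_pos_le_add fun ε hε => ?_
  obtain ⟨u, v, h, hlt⟩ := exists_lt_matrixDual_add (m := m) (n := n) C (div_pos hε ha)
  have := matrixDual_le hm hn hm1 hn1 (C := a • C) (u := a • u) (v := a • v) fun i j => by
    simp only [Pi.smul_apply, smul_eq_mul, ← mul_add]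
    exact mul_le_mul_of_nonneg_left (h i j) ha.le
  refine this.trans ?_
  have key : ∑ i, m i * (a • u) i + ∑ j, n j * (a • v) j
      = a * (∑ i, m i * u i + ∑ j, n j * v j) := by
    simp only [mul_add, Finset.mul_sum, Pi.smul_apply, smul_eq_mul, mul_left_comm]
  rw [key]
  calc _ ≤ a * (matrixDual m n C + ε / a) := mul_le_mul_of_nonneg_left hlt.le ha.le
    _ = _ := by field_simp

theorem matrixDual_smul (hm : ∀ i, 0 ≤ m i) (hn : ∀ j, 0 ≤ n j) (hm1 : ∑ i, m i = 1)
    (hn1 : ∑ j, n j = 1) {a : ℝ} (ha : 0 < a) (C : ι → κ → ℝ) :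
    matrixDual m n (a • C) = a * matrixDual m n C := by
  refine (matrixDual_smul_le hm hn hm1 hn1 ha C).antisymm ?_
  have h := matrixDual_smul_le hm hn hm1 hn1 (inv_pos.2 ha) (a • C)
  rw [inv_smul_smul₀ ha.ne'] at h
  calc _ ≤ a * (a⁻¹ * matrixDual m n (a • C)) := mul_le_mul_of_nonneg_left h ha.le
    _ = _ := mul_inv_cancel_left₀ ha.ne' _

/-- Kantorovich duality for finite sets: the dual value is the value of some transport plan. -/
theorem exists_plan_eq_matrixDual (hm : ∀ i, 0 ≤ m i) (hn : ∀ j, 0 ≤ n j) (hm1 : ∑ i, m i = 1)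
    (hn1 : ∑ j, n j = 1) (C : ι → κ → ℝ) :
    ∃ p : ι → κ → ℝ, (∀ i j, 0 ≤ p i j) ∧ (∀ i, ∑ j, p i j = m i) ∧ (∀ j, ∑ i, p i j = n j) ∧
      matrixDual m n C ≤ ∑ i, ∑ j, p i j * C i j := by
  classical
  -- A linear functional with prescribed value at `C` exists on its span only for `C ≠ 0`; for `C =
  -- 0` the product plan serves.
  by_cases hC : C = 0
  · refine ⟨fun i j => m i * n j, fun i j => mul_nonneg (hm i) (hn j), fun i => ?_, fun j => ?_, ?_⟩
    · rw [← Finset.mul_sum, hn1, mul_one]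
    · rw [← Finset.sum_mul, hm1, one_mul]
    · simpa [hC] using matrixDual_le hm hn hm1 hn1 (C := C) (u := 0) (v := 0) (by simp [hC])
  have h0 : 0 ≤ matrixDual m n (0 : ι → κ → ℝ) := by
    have := matrixDual_smul hm hn hm1 hn1 two_pos (0 : ι → κ → ℝ)
    rw [smul_zero] at this
    linarith
  have hneg (D : ι → κ → ℝ) : -matrixDual m n (-D) ≤ matrixDual m n D := by
    have := matrixDual_add_le hm hn hm1 hn1 D (-D)
    rw [add_neg_cancel] at this
    linarith
  -- Hahn–Banach: `matrixDual m n` is sublinear, and `ℓ` is a linear minorant of it that agrees with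
  -- it at `C`.
  obtain ⟨ℓ, hℓC, hℓ⟩ := exists_extension_of_le_sublinear
    (LinearPMap.mkSpanSingleton (K := ℝ) C (matrixDual m n C) hC) (matrixDual m n)
    (fun a ha D => matrixDual_smul hm hn hm1 hn1 ha D) (matrixDual_add_le hm hn hm1 hn1) (by
      rintro ⟨D, hD⟩
      obtain ⟨a, rfl⟩ := Submodule.mem_span_singleton.1 hD
      rw [LinearPMap.mkSpanSingleton'_apply]
      rcases lt_trichotomy a 0 with ha | rfl | ha
      · have h1 := matrixDual_smul hm hn hm1 hn1 (neg_pos.2 ha) C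
        have h2 := hneg (a • C)
        rw [← neg_smul, h1] at h2
        simpa using h2
      · simpa using h0
      · exact (matrixDual_smul hm hn hm1 hn1 ha C).ge)
  have hℓC' : ℓ C = matrixDual m n C := by
    have := hℓC ⟨C, Submodule.mem_span_singleton_self C⟩
    rw [this]
    exact LinearPMap.mkSpanSingleton_apply ℝ ℝ hC _
  -- Separable costs have exact potentials, and so do their negatives; domination by `matrixDual` at
  -- both signs fixes `ℓ` there.
  have hsep (u : ι → ℝ) (v : κ → ℝ) :
      ℓ (fun i j => u i + v j) = ∑ i, m i * u i + ∑ j, n j * v j := by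
    refine le_antisymm ((hℓ _).trans (matrixDual_le hm hn hm1 hn1 fun _ _ => le_rfl)) ?_
    have h1 := (hℓ (-fun i j => u i + v j)).trans
      (matrixDual_le hm hn hm1 hn1 (u := -u) (v := -v) fun i j => by
        simp only [Pi.neg_apply]
        linarith)
    simp only [map_neg, Pi.neg_apply, mul_neg, Finset.sum_neg_distrib] at h1
    linarith
  set e : ι → κ → ι → κ → ℝ := fun i j i' j' => if i = i' ∧ j = j' then 1 else 0 with he
  have hdecomp (D : ι → κ → ℝ) : D = ∑ i, ∑ j, D i j • e i j := by
    ext i' j'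
    simp [he, Finset.sum_apply, ite_and]
  have hℓD (D : ι → κ → ℝ) : ℓ D = ∑ i, ∑ j, ℓ (e i j) * D i j := by
    conv_lhs => rw [hdecomp D]
    simp only [map_sum, map_smul, smul_eq_mul, mul_comm]
  -- The plan is `ℓ` on matrix units. Zero potentials dominate `-e i j`, which gives positivity; row
  -- and column indicators are separable, which gives the marginals.
  refine ⟨fun i j => ℓ (e i j), fun i j => ?_, fun i => ?_, fun j => ?_, ?_⟩
  · have h1 := (hℓ (-e i j)).trans (matrixDual_le hm hn hm1 hn1 (u := 0) (v := 0) fun i' j' => by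
      simp only [he, Pi.neg_apply, Pi.zero_apply, add_zero, neg_nonpos]
      split_ifs <;> norm_num)
    simpa using h1
  · have h1 := hsep (fun i' => if i' = i then 1 else 0) 0
    rw [hℓD] at h1
    simpa using h1
  · have h1 := hsep 0 (fun j' => if j' = j then 1 else 0)
    rw [hℓD] at h1
    simpa using h1
  · rw [← hℓD, hℓC']

end Finite

/-! ### Duality for costs that factor through finite sets -/

section Discrete

theorem ae_measureReal_preimage_ne_zero {X ι : Type*} [MeasurableSpace X] [Fintype ι]
    (μ : Measure X) [IsFiniteMeasure μ] (t : X → ι) :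
    ∀ᵐ x ∂μ, μ.real (t ⁻¹' {t x}) ≠ 0 := by
  have h : μ (⋃ i ∈ {i | μ.real (t ⁻¹' {i}) = 0}, t ⁻¹' {i}) = 0 := by
    refine (measure_biUnion_null_iff (Set.to_countable _)).2 fun i hi => ?_
    exact (measureReal_eq_zero_iff).1 hi
  refine measure_mono_null (fun x hx => ?_) h
  simpa using hx

variable {X Y ι κ : Type*} [MeasurableSpace X] [MeasurableSpace Y]
  [Fintype ι] [MeasurableSpace ι] [MeasurableSingletonClass ι]
  [Fintype κ] [MeasurableSpace κ] [MeasurableSingletonClass κ]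

theorem integral_comp_fintype (μ : Measure X) [IsFiniteMeasure μ] {t : X → ι} (ht : Measurable t)
    (u : ι → ℝ) : ∫ x, u (t x) ∂μ = ∑ i, μ.real (t ⁻¹' {i}) * u i := by
  rw [← integral_map (f := u) ht.aemeasurable
    (measurable_of_finite u).aestronglyMeasurable, integral_fintype .of_finite]
  simp only [smul_eq_mul, map_measureReal_apply ht (measurableSet_singleton _)]

theorem integrable_comp_finite (μ : Measure X) [IsFiniteMeasure μ] {t : X → ι} (ht : Measurable t)
    (u : ι → ℝ) : Integrable (fun x => u (t x)) μ :=
  Integrable.comp_measurable (f := t) (g := u) .of_finite ht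

theorem sum_measureReal_preimage (μ : Measure X) [IsProbabilityMeasure μ] {t : X → ι}
    (ht : Measurable t) : ∑ i, μ.real (t ⁻¹' {i}) = 1 := by
  simpa using (integral_comp_fintype μ ht fun _ => 1).symm

theorem lintegral_comp_eq_one (μ : Measure X) [IsFiniteMeasure μ] {t : X → ι} (ht : Measurable t)
    {W : ι → ℝ} (hW : ∀ i, 0 ≤ W i) (h1 : ∑ i, μ.real (t ⁻¹' {i}) * W i = 1) :
    ∫⁻ x, ENNReal.ofReal (W (t x)) ∂μ = 1 := by
  rw [← ofReal_integral_eq_lintegral_ofReal (integrable_comp_finite μ ht W)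
    (Filter.Eventually.of_forall fun x => hW _), integral_comp_fintype μ ht, h1,
    ENNReal.ofReal_one]

/-- A plan on finite sets lifts to a coupling. -/
theorem exists_coupling_of_plan (μ : Measure X) [IsProbabilityMeasure μ] (ν : Measure Y)
    [IsProbabilityMeasure ν] {t : X → ι} (ht : Measurable t) {s : Y → κ} (hs : Measurable s)
    {p : ι → κ → ℝ} (hp : ∀ i j, 0 ≤ p i j) (hpm : ∀ i, ∑ j, p i j = μ.real (t ⁻¹' {i}))
    (hpn : ∀ j, ∑ i, p i j = ν.real (s ⁻¹' {j})) :
    ∃ P ∈ couplings μ ν, ∀ C : ι → κ → ℝ,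
      ∫ z, C (t z.1) (s z.2) ∂P = ∑ i, ∑ j, p i j * C i j := by
  set m : ι → ℝ := fun i => μ.real (t ⁻¹' {i})
  set n : κ → ℝ := fun j => ν.real (s ⁻¹' {j})
  have hm0 (i j) (h : m i = 0) : p i j = 0 :=
    (Finset.sum_eq_zero_iff_of_nonneg fun j _ => hp i j).1 ((hpm i).trans h) j (Finset.mem_univ j)
  have hn0 (i j) (h : n j = 0) : p i j = 0 :=
    (Finset.sum_eq_zero_iff_of_nonneg fun i _ => hp i j).1 ((hpn j).trans h) i (Finset.mem_univ i)
  -- The density is constant on products of fibres. Where a fibre has mass zero the quotient is `0`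
  -- by convention, consistently with `p` vanishing there.
  set w : ι → κ → ℝ := fun i j => p i j / (m i * n j) with hw
  have hw0 (i j) : 0 ≤ w i j := div_nonneg (hp i j) (mul_nonneg measureReal_nonneg measureReal_nonneg)
  have hmw (i j) (h : n j ≠ 0) : m i * w i j = p i j / n j := by
    by_cases hi : m i = 0
    · simp [hi, hm0 i j hi]
    · simp only [hw]; field_simp
  have hnw (i j) (h : m i ≠ 0) : n j * w i j = p i j / m i := by
    by_cases hj : n j = 0
    · simp [hj, hn0 i j hj]
    · simp only [hw]; field_simp
  have hmnw (i j) : m i * (n j * w i j) = p i j := by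
    by_cases hi : m i = 0
    · simp [hi, hm0 i j hi]
    · rw [hnw i j hi]; field_simp
  have hmeas : Measurable fun z : X × Y => ENNReal.ofReal (w (t z.1) (s z.2)) :=
    (((measurable_of_finite (Function.uncurry w)).comp
      ((ht.comp measurable_fst).prodMk (hs.comp measurable_snd)))).ennreal_ofReal
  set P := (μ.prod ν).withDensity fun z => ENNReal.ofReal (w (t z.1) (s z.2)) with hP
  have hfst : P.map Prod.fst = μ := by
    ext E hE
    rw [Measure.map_apply measurable_fst hE, ← Set.prod_univ,
      withDensity_apply _ (hE.prod .univ), setLIntegral_prod _ hmeas.aemeasurable]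
    have h1 : ∀ᵐ x ∂μ.restrict E,
        ∫⁻ y in Set.univ, ENNReal.ofReal (w (t x) (s y)) ∂ν = 1 := by
      filter_upwards [ae_restrict_of_ae (ae_measureReal_preimage_ne_zero μ t)] with x hx
      rw [Measure.restrict_univ]
      refine lintegral_comp_eq_one ν hs (hw0 _) ?_
      calc ∑ j, n j * w (t x) j = ∑ j, p (t x) j / m (t x) :=
            Finset.sum_congr rfl fun j _ => hnw _ j hx
        _ = 1 := by rw [← Finset.sum_div, hpm, div_self hx]
    rw [lintegral_congr_ae h1, lintegral_one, Measure.restrict_apply_univ]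
  have hsnd : P.map Prod.snd = ν := by
    ext E hE
    rw [Measure.map_apply measurable_snd hE, ← Set.univ_prod,
      withDensity_apply _ (MeasurableSet.univ.prod hE),
      setLIntegral_prod_symm _ hmeas.aemeasurable]
    have h1 : ∀ᵐ y ∂ν.restrict E,
        ∫⁻ x in Set.univ, ENNReal.ofReal (w (t x) (s y)) ∂μ = 1 := by
      filter_upwards [ae_restrict_of_ae (ae_measureReal_preimage_ne_zero ν s)] with y hy
      rw [Measure.restrict_univ]
      refine lintegral_comp_eq_one μ ht (W := fun i => w i (s y)) (fun i => hw0 i _) ?_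
      calc ∑ i, m i * w i (s y) = ∑ i, p i (s y) / n (s y) :=
            Finset.sum_congr rfl fun i _ => hmw i _ hy
        _ = 1 := by rw [← Finset.sum_div, hpn, div_self hy]
    rw [lintegral_congr_ae h1, lintegral_one, Measure.restrict_apply_univ]
  refine ⟨P, ⟨⟨?_⟩, hfst, hsnd⟩, fun C => ?_⟩
  · rw [← Set.preimage_univ (f := Prod.fst), ← Measure.map_apply measurable_fst .univ, hfst,
      measure_univ]
  · rw [hP, integral_withDensity_eq_integral_toReal_smul hmeas
      (Filter.Eventually.of_forall fun _ => ENNReal.ofReal_lt_top)]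
    simp only [ENNReal.toReal_ofReal (hw0 _ _), smul_eq_mul]
    rw [integral_prod _ (integrable_comp_finite (t := fun z : X × Y => (t z.1, s z.2)) (μ.prod ν)
      ((ht.comp measurable_fst).prodMk (hs.comp measurable_snd)) fun q => w q.1 q.2 * C q.1 q.2)]
    have h1 (x : X) := integral_comp_fintype ν hs fun j => w (t x) j * C (t x) j
    simp only [h1]
    rw [integral_comp_fintype μ ht fun i => ∑ j, ν.real (s ⁻¹' {j}) * (w i j * C i j)]
    refine Finset.sum_congr rfl fun i _ => ?_
    rw [Finset.mul_sum]
    refine Finset.sum_congr rfl fun j _ => ?_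
    rw [← hmnw i j]
    ring

/-- Duality, up to `ε` and with nonnegative potentials, for nonnegative costs that factor through
finite sets. -/
theorem exists_coupling_dual_le (μ : Measure X) [IsProbabilityMeasure μ] (ν : Measure Y)
    [IsProbabilityMeasure ν] {t : X → ι} (ht : Measurable t) {s : Y → κ} (hs : Measurable s)
    {C : ι → κ → ℝ} (hC : ∀ i j, 0 ≤ C i j) {ε : ℝ} (hε : 0 < ε) :
    ∃ P ∈ couplings μ ν, ∃ (u : ι → ℝ) (v : κ → ℝ), (∀ i, 0 ≤ u i) ∧ (∀ j, 0 ≤ v j) ∧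
      (∀ i j, C i j ≤ u i + v j) ∧
      ∫ x, u (t x) ∂μ + ∫ y, v (s y) ∂ν ≤ ∫ z, C (t z.1) (s z.2) ∂P + ε := by
  have hm1 := sum_measureReal_preimage μ ht
  have hn1 := sum_measureReal_preimage ν hs
  obtain ⟨p, hp, hpm, hpn, hpC⟩ := exists_plan_eq_matrixDual (fun _ => measureReal_nonneg)
    (fun _ => measureReal_nonneg) hm1 hn1 C
  obtain ⟨P, hP, hPC⟩ := exists_coupling_of_plan μ ν ht hs hp hpm hpn
  obtain ⟨u, v, huv, hlt⟩ := exists_lt_matrixDual_add (m := fun i => μ.real (t ⁻¹' {i}))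
    (n := fun j => ν.real (s ⁻¹' {j})) C hε
  obtain ⟨x₀⟩ := nonempty_of_isProbabilityMeasure μ
  have : Nonempty ι := ⟨t x₀⟩
  obtain ⟨i₀, hi₀⟩ := Finite.exists_min u
  -- Moving the minimum of `u` over to `v` keeps sums and total value; then `v j + u i₀ ≥ C i₀ j ≥
  -- 0`.
  refine ⟨P, hP, fun i => u i - u i₀, fun j => v j + u i₀, fun i => sub_nonneg.2 (hi₀ i),
    fun j => ?_, fun i j => ?_, ?_⟩
  · have := huv i₀ j
    have := hC i₀ j
    linarith
  · have := huv i j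
    linarith
  · rw [integral_sub (integrable_comp_finite μ ht u) (integrable_const _),
      integral_add (integrable_comp_finite ν hs v) (integrable_const _),
      integral_comp_fintype μ ht, integral_comp_fintype ν hs, hPC]
    simp only [integral_const, probReal_univ, one_smul]
    linarith

end Discrete

open Filter Topology ENNReal

/-! ### Near minimisers of the `L²` norm -/

/-- In a decreasing sequence of midpoint convex sets of uniformly bounded measurable functions one
can choose members that converge almost everywhere. -/
theorem exists_ae_tendsto_of_antitone_midpoint {Z : Type*} [MeasurableSpace Z] (ρ : Measure Z)
    [IsFiniteMeasure ρ] {K : ℝ} {S : ℕ → Set (Z → ℝ)} (hS : Antitone S)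
    (hne : ∀ n, (S n).Nonempty) (hmeas : ∀ n, ∀ f ∈ S n, Measurable f)
    (hbdd : ∀ n, ∀ f ∈ S n, ∀ z, |f z| ≤ K)
    (hmid : ∀ n, ∀ f ∈ S n, ∀ g ∈ S n, (fun z => (f z + g z) / 2) ∈ S n) :
    ∃ u : ℕ → Z → ℝ, (∀ n, u n ∈ S n) ∧
      ∀ᵐ z ∂ρ, ∃ l, Tendsto (fun n => u n z) atTop (𝓝 l) := by
  have hint {f : Z → ℝ} (hf : Measurable f) {M : ℝ} (hM : ∀ z, |f z| ≤ M) :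
      Integrable (fun z => f z ^ 2) ρ := by
    refine Integrable.of_bound (hf.pow_const 2).aestronglyMeasurable (M ^ 2)
      (Eventually.of_forall fun z => ?_)
    rw [Real.norm_eq_abs, abs_pow]
    exact pow_le_pow_left₀ (abs_nonneg _) (hM z) 2
  set φ : (Z → ℝ) → ℝ := fun f => ∫ z, f z ^ 2 ∂ρ with hφ
  have hφ0 (f : Z → ℝ) : 0 ≤ φ f := integral_nonneg fun z => sq_nonneg _
  -- Parallelogram identity: two near minimisers whose midpoint is admissible must be close in `L²`.
  have hpar {f g : Z → ℝ} {n : ℕ} (hf : f ∈ S n) (hg : g ∈ S n) :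
      φ (f - g) = 2 * φ f + 2 * φ g - 4 * φ (fun z => (f z + g z) / 2) := by
    have h1 := hint (hmeas n f hf) (hbdd n f hf)
    have h2 := hint (hmeas n g hg) (hbdd n g hg)
    have h3 := hint (hmeas n _ (hmid n f hf g hg)) (hbdd n _ (hmid n f hf g hg))
    simp only [hφ]
    rw [← integral_const_mul, ← integral_const_mul, ← integral_const_mul,
      ← integral_add (h1.const_mul 2) (h2.const_mul 2),
      ← integral_sub (by exact (h1.const_mul 2).add (h2.const_mul 2)) (h3.const_mul 4)]
    congr 1
    ext z
    simp only [Pi.sub_apply]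
    ring
  set I : ℕ → ℝ := fun n => sInf (φ '' S n)
  have hbb (n : ℕ) : BddBelow (φ '' S n) := ⟨0, by rintro _ ⟨f, -, rfl⟩; exact hφ0 f⟩
  have hImono : Monotone I := fun a b hab =>
    csInf_le_csInf (hbb a) ((hne b).image φ) (Set.image_mono (hS hab))
  have hIbdd : BddAbove (Set.range I) := by
    refine ⟨ρ.real Set.univ * K ^ 2, ?_⟩
    rintro _ ⟨n, rfl⟩
    obtain ⟨f, hf⟩ := hne n
    refine (csInf_le (hbb n) ⟨f, hf, rfl⟩).trans ?_
    calc φ f ≤ ∫ _, K ^ 2 ∂ρ := integral_mono (hint (hmeas n f hf) (hbdd n f hf))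
          (integrable_const _) fun z => by
            simp only
            rw [← sq_abs]
            exact pow_le_pow_left₀ (abs_nonneg _) (hbdd n f hf z) 2
      _ = _ := by simp
  set J := ⨆ n, I n
  have hIJ : Tendsto I atTop (𝓝 J) := tendsto_atTop_ciSup hImono hIbdd
  -- Two members within `δ N` above `J`, with midpoint at least `J - δ N`, have squared distance
  -- below `8 * δ N = (1 / 4) ^ N / 2`; the `L²` distances are then dominated by the summable `(1 /
  -- 2) ^ N`.
  set δ : ℕ → ℝ := fun N => (1 / 4) ^ N / 16 with hδ
  have hδ0 (N : ℕ) : 0 < δ N := by positivity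
  have hδanti : Antitone δ := fun a b hab => by
    simp only [hδ]
    gcongr ?_ / 16
    exact pow_le_pow_of_le_one (by norm_num) (by norm_num) hab
  obtain ⟨k, hk, hkJ⟩ := extraction_forall_of_eventually (P := fun N q => J - δ N < I q)
    fun N => hIJ.eventually (lt_mem_nhds (sub_lt_self J (hδ0 N)))
  have hsel (N : ℕ) : ∃ f ∈ S (k N), φ f < J + δ N := by
    obtain ⟨_, ⟨f, hf, rfl⟩, hlt⟩ := exists_lt_of_csInf_lt ((hne (k N)).image φ)
      (show I (k N) < J + δ N from (le_ciSup hIbdd (k N)).trans_lt (lt_add_of_pos_right _ (hδ0 N)))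
    exact ⟨f, hf, hlt⟩
  choose u huS huJ using hsel
  refine ⟨u, fun n => hS hk.le_apply (huS n), ?_⟩
  have hum (n : ℕ) : Measurable (u n) := hmeas _ _ (huS n)
  have hcau (N a b : ℕ) (ha : N ≤ a) (hb : N ≤ b) : φ (u a - u b) < (1 / 4) ^ N := by
    have hfa : u a ∈ S (k N) := hS (hk.monotone ha) (huS a)
    have hfb : u b ∈ S (k N) := hS (hk.monotone hb) (huS b)
    have h1 := hpar hfa hfb
    have h2 : I (k N) ≤ _ := csInf_le (hbb (k N)) ⟨_, hmid _ _ hfa _ hfb, rfl⟩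
    have h3 := hkJ N
    have h4 := huJ a
    have h5 := huJ b
    have h6 := hδanti ha
    have h7 := hδanti hb
    have h8 : δ N = (1 / 4) ^ N / 16 := rfl
    have h9 := hδ0 N
    linarith
  refine Lp.ae_tendsto_of_cauchy_eLpNorm (p := 2) (B := fun N => ENNReal.ofReal ((1 / 2) ^ N))
    (fun n => (hum n).aestronglyMeasurable) one_le_two ?_ fun N a b ha hb => ?_
  · rw [← ENNReal.ofReal_tsum_of_nonneg (fun N => by positivity)
      (summable_geometric_of_lt_one (by norm_num) (by norm_num))]
    exact ENNReal.ofReal_ne_top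
  · have hLp : MemLp (u a - u b) 2 ρ := by
      refine MemLp.of_bound ((hum a).sub (hum b)).aestronglyMeasurable (K + K)
        (Eventually.of_forall fun z => ?_)
      exact (norm_sub_le _ _).trans (add_le_add (hbdd _ _ (huS a) z) (hbdd _ _ (huS b) z))
    rw [hLp.eLpNorm_eq_integral_rpow_norm two_ne_zero ENNReal.ofNat_ne_top]
    refine (ENNReal.ofReal_lt_ofReal_iff (by positivity)).2 ?_
    have h1 : ∫ z, ‖(u a - u b) z‖ ^ (2 : ℝ≥0∞).toReal ∂ρ = φ (u a - u b) := by simp [hφ]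
    rw [h1, ENNReal.toReal_ofNat, ← one_div, ← Real.sqrt_eq_rpow,
      Real.sqrt_lt' (by positivity), ← pow_mul, mul_comm, pow_mul]
    refine (hcau N a b ha hb).trans_eq ?_
    norm_num

/-- Uniformly bounded dual potentials for an increasing sequence of costs yield potentials, with
the same bound on the dual value, that work for all the costs at once off null sets. -/
theorem exists_potentials_of_monotone {X Y : Type*} [MeasurableSpace X] [MeasurableSpace Y]
    (μ : Measure X) [IsProbabilityMeasure μ] (ν : Measure Y) [IsProbabilityMeasure ν]
    {d : ℕ → X → Y → ℝ} (hd : Monotone d) {K V : ℝ}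
    (H : ∀ n, ∃ (h : X → ℝ) (k : Y → ℝ), Measurable h ∧ Measurable k ∧ (∀ x, |h x| ≤ K) ∧
      (∀ y, |k y| ≤ K) ∧ (∀ x y, d n x y ≤ h x + k y) ∧ ∫ x, h x ∂μ + ∫ y, k y ∂ν ≤ V) :
    ∃ (h : X → ℝ) (k : Y → ℝ) (N : Set X) (M : Set Y), Measurable h ∧ Measurable k ∧
      MeasurableSet N ∧ μ N = 0 ∧ MeasurableSet M ∧ ν M = 0 ∧
      (∀ x ∉ N, |h x| ≤ K) ∧ (∀ y ∉ M, |k y| ≤ K) ∧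
      (∀ x ∉ N, ∀ y ∉ M, ∀ n, d n x y ≤ h x + k y) ∧ ∫ x, h x ∂μ + ∫ y, k y ∂ν ≤ V := by
  have hintX {f : X → ℝ} (hf : Measurable f) (hK : ∀ x, |f x| ≤ K) : Integrable f μ :=
    .of_bound hf.aestronglyMeasurable K (Eventually.of_forall hK)
  have hintY {f : Y → ℝ} (hf : Measurable f) (hK : ∀ x, |f x| ≤ K) : Integrable f ν :=
    .of_bound hf.aestronglyMeasurable K (Eventually.of_forall hK)
  -- A pair of potentials is encoded as one function on `X ⊕ Y`, so that a single selection makes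
  -- both components converge.
  set S : ℕ → Set (X ⊕ Y → ℝ) := fun n => {F | Measurable F ∧ (∀ z, |F z| ≤ K) ∧
    (∀ x y, d n x y ≤ F (.inl x) + F (.inr y)) ∧
    ∫ x, F (.inl x) ∂μ + ∫ y, F (.inr y) ∂ν ≤ V}
  obtain ⟨u, huS, hu⟩ := exists_ae_tendsto_of_antitone_midpoint
    (μ.map Sum.inl + ν.map Sum.inr) (K := K) (S := S)
    (fun a b hab F hF => ⟨hF.1, hF.2.1, fun x y => (hd hab x y).trans (hF.2.2.1 x y), hF.2.2.2⟩)
    (fun n => by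
      obtain ⟨h, k, hh, hk, hhK, hkK, hle, hV⟩ := H n
      exact ⟨Sum.elim h k, hh.sumElim hk, by rintro (x | y); exacts [hhK x, hkK y], hle, hV⟩)
    (fun n F hF => hF.1) (fun n F hF => hF.2.1) (by
      rintro n F ⟨hF, hFK, hFd, hFV⟩ G ⟨hG, hGK, hGd, hGV⟩
      refine ⟨(hF.add hG).div_const 2, fun z => ?_, fun x y => ?_, ?_⟩
      · have h1 := abs_le.1 (hFK z)
        have h2 := abs_le.1 (hGK z)
        exact abs_le.2 ⟨by linarith, by linarith⟩
      · have := hFd x y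
        have := hGd x y
        linarith
      · rw [integral_div, integral_div,
          integral_add (by exact hintX (hF.comp measurable_inl) fun x => hFK _)
            (by exact hintX (hG.comp measurable_inl) fun x => hGK _),
          integral_add (by exact hintY (hF.comp measurable_inr) fun x => hFK _)
            (by exact hintY (hG.comp measurable_inr) fun x => hGK _)]
        linarith)
  rw [ae_add_measure_iff] at hu
  have hm1 (n : ℕ) : Measurable fun x => u n (.inl x) := (huS n).1.comp measurable_inl
  have hm2 (n : ℕ) : Measurable fun y => u n (.inr y) := (huS n).1.comp measurable_inr
  obtain ⟨h, hh, hlim⟩ := measurable_limit_of_tendsto_metrizable_ae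
    (fun n => (hm1 n).aemeasurable) (ae_of_ae_map measurable_inl.aemeasurable hu.1)
  obtain ⟨k, hk, klim⟩ := measurable_limit_of_tendsto_metrizable_ae
    (fun n => (hm2 n).aemeasurable) (ae_of_ae_map measurable_inr.aemeasurable hu.2)
  set N := toMeasurable μ {x | ¬ Tendsto (fun n => u n (.inl x)) atTop (𝓝 (h x))}
  set M := toMeasurable ν {y | ¬ Tendsto (fun n => u n (.inr y)) atTop (𝓝 (k y))}
  have hNt (x) (hx : x ∉ N) : Tendsto (fun n => u n (.inl x)) atTop (𝓝 (h x)) := by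
    by_contra hcon
    exact hx (subset_toMeasurable _ _ hcon)
  have hMt (y) (hy : y ∉ M) : Tendsto (fun n => u n (.inr y)) atTop (𝓝 (k y)) := by
    by_contra hcon
    exact hy (subset_toMeasurable _ _ hcon)
  refine ⟨h, k, N, M, hh, hk, measurableSet_toMeasurable _ _, ?_, measurableSet_toMeasurable _ _,
    ?_, fun x hx => ?_, fun y hy => ?_, fun x hx y hy n => ?_, ?_⟩
  · rw [measure_toMeasurable]
    exact hlim
  · rw [measure_toMeasurable]
    exact klim
  · exact le_of_tendsto (hNt x hx).abs (Eventually.of_forall fun n => (huS n).2.1 _)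
  · exact le_of_tendsto (hMt y hy).abs (Eventually.of_forall fun n => (huS n).2.1 _)
  · refine ge_of_tendsto ((hNt x hx).add (hMt y hy)) ?_
    filter_upwards [eventually_ge_atTop n] with l hl
    exact (hd hl x y).trans ((huS l).2.2.1 x y)
  · refine le_of_tendsto ((tendsto_integral_of_dominated_convergence (fun _ => K)
      (fun n => (hm1 n).aestronglyMeasurable) (integrable_const _)
      (fun n => Eventually.of_forall fun x => (huS n).2.1 _) hlim).add
      (tendsto_integral_of_dominated_convergence (fun _ => K)
      (fun n => (hm2 n).aestronglyMeasurable) (integrable_const _)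
      (fun n => Eventually.of_forall fun x => (huS n).2.1 _) klim))
      (Eventually.of_forall fun n => (huS n).2.2.2)

open NNReal

/-! ### Approximation from below by finite maxima of rectangles -/

/-- On `X × B` with `B` separable, a nonnegative cost that is measurable in the first and continuous
in the second variable is a supremum of countably many multiples of indicators of rectangles. -/
theorem exists_rectangles {X Y : Type*} [MeasurableSpace X] [PseudoMetricSpace Y]
    [MeasurableSpace Y] [OpensMeasurableSpace Y] {c : X × Y → ℝ}
    (hcx : ∀ y, Measurable fun x => c (x, y)) (hcy : ∀ x, Continuous fun y => c (x, y))
    {B : Set Y} (hB : MeasurableSet B) (hBs : TopologicalSpace.IsSeparable B) (hBne : B.Nonempty) :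
    ∃ (q : ℕ → ℝ≥0) (A : ℕ → Set X) (E : ℕ → Set Y), (∀ k, MeasurableSet (A k)) ∧
      (∀ k, MeasurableSet (E k)) ∧ (∀ k, ∀ x ∈ A k, ∀ y ∈ E k, q k ≤ c (x, y)) ∧
      ∀ x, ∀ y ∈ B, ∀ a, 0 ≤ a → a < c (x, y) → ∃ k, x ∈ A k ∧ y ∈ E k ∧ a < q k := by
  obtain ⟨D, hDB, hD, hBD⟩ := hBs.exists_countable_dense_subset
  have : Countable D := hD.to_subtype
  have : Nonempty D := (closure_nonempty_iff.1 (hBne.mono hBD)).to_subtype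
  obtain ⟨e, he⟩ := exists_surjective_nat (D × ℚ × ℚ≥0)
  -- `A k` tests only the countable set `D`, hence is measurable; continuity in `y` and density of
  -- `D` carry the inequality to the whole ball within `B`.
  refine ⟨fun k => ((e k).2.2 : ℝ≥0),
    fun k => ⋂ d' ∈ D ∩ Metric.ball ((e k).1 : Y) (e k).2.1, {x | (((e k).2.2 : ℝ≥0) : ℝ) ≤ c (x, d')},
    fun k => Metric.ball ((e k).1 : Y) (e k).2.1 ∩ B, fun k => ?_, fun k => ?_, ?_, ?_⟩
  · exact .biInter (hD.mono Set.inter_subset_left) fun d' _ =>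
      measurableSet_le measurable_const (hcx d')
  · exact Metric.isOpen_ball.measurableSet.inter hB
  · intro k x hx y hy
    have hcl : IsClosed {y | (((e k).2.2 : ℝ≥0) : ℝ) ≤ c (x, y)} := isClosed_le continuous_const (hcy x)
    have hsub : D ∩ Metric.ball ((e k).1 : Y) (e k).2.1 ⊆ {y | (((e k).2.2 : ℝ≥0) : ℝ) ≤ c (x, y)} :=
      fun d' hd' => Set.mem_iInter₂.1 hx d' hd'
    have := hcl.closure_subset_iff.2 hsub (Metric.isOpen_ball.closure_inter ⟨hBD hy.2, hy.1⟩)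
    exact this
  · intro x y hy a ha hac
    obtain ⟨r, har, hrc⟩ := exists_rat_btwn hac
    have hr0 : 0 ≤ r := by exact_mod_cast ha.trans har.le
    obtain ⟨δ, hδ, hball⟩ := Metric.isOpen_iff.1
      (isOpen_lt continuous_const (hcy x) : IsOpen {y | (r : ℝ) < c (x, y)}) y hrc
    obtain ⟨s, hs0, hsδ⟩ := exists_rat_btwn (half_pos hδ)
    obtain ⟨d, hdD, hyd⟩ := Metric.mem_closure_iff.1 (hBD hy) s hs0
    obtain ⟨k, hk⟩ := he (⟨d, hdD⟩, s, ⟨r, hr0⟩)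
    refine ⟨k, ?_, ?_, ?_⟩
    · simp only [hk, Set.mem_iInter, Set.mem_ofPred_eq]
      intro d' hd'
      have h1 : d' ∈ Metric.ball y δ := by
        have h2 : dist d' d < s := hd'.2
        have h3 := dist_triangle_right d' y d
        rw [Metric.mem_ball]
        linarith
      exact (hball h1).le
    · simp only [hk]
      exact ⟨hyd, hy⟩
    · simp only [hk]
      exact har

/-- The maximum of the `q k` over the indices marked by both `b` and `b'`. -/
noncomputable def markedSup (q : ℕ → ℝ≥0) (n : ℕ) (b b' : Fin n → Bool) : ℝ :=
  ((Finset.univ.sup fun k : Fin n => if b k = true ∧ b' k = true then q k else 0 : ℝ≥0) : ℝ)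

/-- The indicator vector of the membership of a point in the first `n` sets. -/
noncomputable def marks {Z : Type*} (A : ℕ → Set Z) (n : ℕ) (z : Z) : Fin n → Bool :=
  open Classical in fun k => decide (z ∈ A k)

theorem measurable_marks {Z : Type*} [MeasurableSpace Z] {A : ℕ → Set Z}
    (hA : ∀ k, MeasurableSet (A k)) (n : ℕ) : Measurable (marks A n) := by
  refine measurable_pi_iff.2 fun k => measurable_to_bool ?_
  convert hA k using 1
  ext z
  simp [marks]

variable {X Y : Type*} {q : ℕ → ℝ≥0} {A : ℕ → Set X} {E : ℕ → Set Y}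

theorem monotone_markedSup_marks :
    Monotone fun n x y => markedSup q n (marks A n x) (marks E n y) := by
  intro n n' hn x y
  refine NNReal.coe_le_coe.2 (Finset.sup_le fun k _ => ?_)
  exact Finset.le_sup (f := fun k : Fin n' =>
    if marks A n' x k = true ∧ marks E n' y k = true then q k else 0) (Finset.mem_univ (k.castLE hn))

theorem markedSup_marks_le {c : X × Y → ℝ} (hc : ∀ z, 0 ≤ c z)
    (h : ∀ k, ∀ x ∈ A k, ∀ y ∈ E k, q k ≤ c (x, y)) (n : ℕ) (x : X) (y : Y) :
    markedSup q n (marks A n x) (marks E n y) ≤ c (x, y) := by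
  lift c to X × Y → ℝ≥0 using hc
  refine NNReal.coe_le_coe.2 (Finset.sup_le fun k _ => ?_)
  split_ifs with hk
  · simp only [marks, decide_eq_true_eq] at hk
    exact_mod_cast h k x hk.1 y hk.2
  · exact zero_le

theorem le_markedSup_marks {k : ℕ} {x : X} {y : Y} (hx : x ∈ A k) (hy : y ∈ E k) :
    q k ≤ markedSup q (k + 1) (marks A (k + 1) x) (marks E (k + 1) y) := by
  refine NNReal.coe_le_coe.2 ?_
  have := Finset.le_sup (f := fun j : Fin (k + 1) =>
    if marks A (k + 1) x j = true ∧ marks E (k + 1) y j = true then q j else 0)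
    (Finset.mem_univ (Fin.last k))
  simpa [marks, hx, hy] using this

/-! ### Measurability and integrability of the cost under couplings -/

section Measurability

theorem measure_preimage_snd_of_mem_couplings {X Y : Type*} [MeasurableSpace X]
    [MeasurableSpace Y] {μ : Measure X} {ν : Measure Y} {P : Measure (X × Y)}
    (hP : P ∈ couplings μ ν) {B : Set Y} (hB : MeasurableSet B) : P (Prod.snd ⁻¹' B) = ν B := by
  rw [← hP.2.2, Measure.map_apply measurable_snd hB]

variable {X Y : Type*} [MeasurableSpace X] [MetricSpace Y] [MeasurableSpace Y] [BorelSpace Y]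
  {μ : Measure X} {ν : Measure Y}

/-- `P` is carried by `X × B`, and `B` is second countable, so there `c` is a Carathéodory function
and hence jointly measurable. -/
theorem aemeasurable_of_mem_couplings {c : X × Y → ℝ} (hcx : ∀ y, Measurable fun x => c (x, y))
    (hcy : ∀ x, Continuous fun y => c (x, y)) (hν : IsSeparableMeasure ν) {P : Measure (X × Y)}
    (hP : P ∈ couplings μ ν) : AEMeasurable c P := by
  obtain ⟨B, hB, hBs, hB1⟩ := hν
  have := hP.1
  have hBm : MeasurableSet (Prod.snd ⁻¹' B : Set (X × Y)) := measurable_snd hB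
  have hae : ∀ᵐ z ∂P, z ∈ (Prod.snd ⁻¹' B : Set (X × Y)) := by
    refine mem_ae_iff.2 ((prob_compl_eq_zero_iff hBm).2 ?_)
    rw [measure_preimage_snd_of_mem_couplings hP hB, hB1]
  rw [← Measure.restrict_eq_self_of_ae_mem hae]
  refine aemeasurable_restrict_of_measurable_subtype hBm ?_
  have : SecondCountableTopology B := by
    have := hBs.separableSpace
    exact UniformSpace.secondCountable_of_separable B
  have h := measurable_uncurry_of_continuous_of_measurable
    (u := fun (y : B) (x : X) => c (x, (y : Y)))
    (fun x => (hcy x).comp continuous_subtype_val) fun y => hcx y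
  exact h.comp (g := Function.uncurry fun (y : B) (x : X) => c (x, (y : Y)))
    (f := fun z : (Prod.snd ⁻¹' B : Set (X × Y)) => ((⟨z.1.2, z.2⟩ : B), z.1.1))
    ((measurable_snd.comp measurable_subtype_coe).subtype_mk.prodMk
      (measurable_fst.comp measurable_subtype_coe))

theorem integrable_of_mem_couplings {c : X × Y → ℝ} (hc : HasIntegrableBounds μ ν c)
    (hcx : ∀ y, Measurable fun x => c (x, y)) (hcy : ∀ x, Continuous fun y => c (x, y))
    (hν : IsSeparableMeasure ν) {P : Measure (X × Y)} (hP : P ∈ couplings μ ν) :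
    Integrable c P := by
  obtain ⟨f₁, f₂, g₁, g₂, hf₁, hf₂, hg₁, hg₂, h₁, h₂⟩ := hc
  have hae := aemeasurable_of_mem_couplings hcx hcy hν hP
  exact integrable_of_le_of_le hae.aestronglyMeasurable (.of_forall fun z => h₁ z.1 z.2)
    (.of_forall fun z => h₂ z.1 z.2) (integral_add_of_mem_couplings hP hf₁ hg₁).1
    (integral_add_of_mem_couplings hP hf₂ hg₂).1

end Measurability

/-! ### Truncation of potentials -/

theorem tendsto_integral_max_sub_zero {Ω : Type*} [MeasurableSpace Ω] {Q : Measure Ω} {f : Ω → ℝ}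
    (hf : IsL1 Q f) (hf0 : ∀ x, 0 ≤ f x) :
    Tendsto (fun K : ℕ => ∫ x, max (f x - K) 0 ∂Q) atTop (𝓝 0) := by
  suffices h : Tendsto (fun K : ℕ => ∫ x, max (f x - K) 0 ∂Q) atTop (𝓝 (∫ _, 0 ∂Q)) by
    rwa [integral_zero] at h
  refine tendsto_integral_of_dominated_convergence f
    (fun K => ((hf.1.sub_const _).max measurable_const).aestronglyMeasurable) hf.2
    (fun K => .of_forall fun x => ?_) (.of_forall fun x => ?_)
  · rw [Real.norm_of_nonneg (le_max_right _ _)]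
    exact max_le (sub_le_self _ K.cast_nonneg) (hf0 x)
  · refine tendsto_const_nhds.congr' ?_
    filter_upwards [eventually_ge_atTop ⌈f x⌉₊] with K hK
    exact (max_eq_right (sub_nonpos.2 (Nat.ceil_le.1 hK))).symm

/-- Clamping raises `u - f` only where it is below `-K`, and then by `f - u - K ≤ f - K` because `u
≥ 0`. The extra term is thus a tail of `f`, small for large `K`. -/
theorem integral_clamp_sub_le {Ω : Type*} [MeasurableSpace Ω] {Q : Measure Ω}
    [IsFiniteMeasure Q] {f u : Ω → ℝ} (hf : IsL1 Q f) (hu : IsL1 Q u) (hu0 : ∀ x, 0 ≤ u x)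
    {K : ℝ} (hK : 0 ≤ K) :
    ∫ x, max (-K) (min K (u x - f x)) ∂Q ≤
      ∫ x, u x ∂Q - ∫ x, f x ∂Q + ∫ x, max (f x - K) 0 ∂Q := by
  have h1 : Integrable (fun x => max (f x - K) 0) Q := (hf.2.sub (integrable_const K)).pos_part
  rw [← integral_sub hu.2 hf.2, ← integral_add (by exact hu.2.sub hf.2) h1]
  refine integral_mono (.of_bound (measurable_const.max
    (measurable_const.min (hu.1.sub hf.1))).aestronglyMeasurable K (.of_forall fun x => ?_))
    ((hu.2.sub hf.2).add h1) fun x => ?_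
  · exact abs_le.2 ⟨le_max_left _ _, max_le (by linarith) (min_le_left _ _)⟩
  · have h2 := hu0 x
    have h3 := le_max_left (f x - K) 0
    have h4 := le_max_right (f x - K) 0
    have h5 := min_le_right K (u x - f x)
    change _ ≤ u x - f x + max (f x - K) 0
    exact max_le (by linarith) (by linarith)

/-- If one summand is cut to `K`, the other is at least `-K` and the sum is at least `0 ≥ r`;
otherwise clamping only raises the summands. -/
theorem le_clamp_add_clamp {a b r K : ℝ} (hr : r ≤ 0) (h : r ≤ a + b) :
    r ≤ max (-K) (min K a) + max (-K) (min K b) := by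
  have h1 := le_max_left (-K) (min K a)
  have h2 := le_max_right (-K) (min K a)
  have h3 := le_max_left (-K) (min K b)
  have h4 := le_max_right (-K) (min K b)
  rcases min_cases K a with ⟨h5, -⟩ | ⟨h5, -⟩ <;> rcases min_cases K b with ⟨h6, -⟩ | ⟨h6, -⟩ <;>
    linarith

/-! ### Duality for nonnegative costs -/

variable {X Y : Type*} [MeasurableSpace X] [MetricSpace Y] [MeasurableSpace Y] [BorelSpace Y]
  {μ : Measure X} {ν : Measure Y} [IsProbabilityMeasure μ] [IsProbabilityMeasure ν]

/-- The core of the duality. The allowance `ε` is split into three parts: the finite dual problem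
and the two truncations. -/
theorem exists_upperDual_le_of_nonneg {c : X × Y → ℝ} (hc0 : ∀ z, 0 ≤ c z) {f₂ : X → ℝ}
    {g₂ : Y → ℝ} (hf₂ : IsL1 μ f₂) (hg₂ : IsL1 ν g₂) (hf0 : ∀ x, 0 ≤ f₂ x) (hg0 : ∀ y, 0 ≤ g₂ y)
    (hle : ∀ x y, c (x, y) ≤ f₂ x + g₂ y) (hcx : ∀ y, Measurable fun x => c (x, y))
    (hcy : ∀ x, Continuous fun y => c (x, y)) (hν : IsSeparableMeasure ν)
    (hi : ∀ P ∈ couplings μ ν, Integrable c P) {L : ℝ}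
    (hL : ∀ r ∈ transportValues μ ν c, r ≤ L) {ε : ℝ} (hε : 0 < ε) :
    ∃ r ∈ upperDualValues μ ν c, r ≤ L + ε := by
  obtain ⟨B, hB, hBs, hB1⟩ := hν
  have hBne : B.Nonempty := nonempty_of_measure_ne_zero (μ := ν) (by simp [hB1])
  obtain ⟨q, A, E, hA, hE, hqc, hcq⟩ := exists_rectangles hcx hcy hB hBs hBne
  obtain ⟨K, hKf, hKg⟩ := (((tendsto_integral_max_sub_zero hf₂ hf0).eventually
    (gt_mem_nhds (by positivity : 0 < ε / 3))).and
    ((tendsto_integral_max_sub_zero hg₂ hg0).eventually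
    (gt_mem_nhds (by positivity : 0 < ε / 3)))).exists
  have hK : (0 : ℝ) ≤ K := K.cast_nonneg
  set cn : ℕ → X → Y → ℝ := fun n x y => markedSup q n (marks A n x) (marks E n y) with hcn
  have hcnc (n x y) : cn n x y ≤ c (x, y) := markedSup_marks_le hc0 hqc n x y
  obtain ⟨h, k, N, M, hh, hk, hN, hN0, hM, hM0, hhK, hkK, hd, hV⟩ :=
    -- Subtracting `f₂ + g₂ ≥ c ≥ c_n` makes the costs nonpositive, as the clamping of potentials
    -- requires.
    exists_potentials_of_monotone μ ν (d := fun n x y => cn n x y - f₂ x - g₂ y) (K := K)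
      (V := L + ε - ∫ x, f₂ x ∂μ - ∫ y, g₂ y ∂ν)
      (fun a b hab x y => by
        have : cn a x y ≤ cn b x y := monotone_markedSup_marks hab x y
        simp only
        linarith) fun n => by
    have hmA := measurable_marks hA n
    have hmE := measurable_marks hE n
    obtain ⟨P, hP, u, v, hu0, hv0, huv, hval⟩ := exists_coupling_dual_le μ ν hmA hmE
      (C := markedSup q n) (fun _ _ => NNReal.coe_nonneg _) (by positivity : 0 < ε / 3)
    have hu : IsL1 μ fun x => u (marks A n x) :=
      ⟨(measurable_of_finite u).comp hmA, integrable_comp_finite μ hmA u⟩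
    have hv : IsL1 ν fun y => v (marks E n y) :=
      ⟨(measurable_of_finite v).comp hmE, integrable_comp_finite ν hmE v⟩
    have hPc : ∫ z, cn n z.1 z.2 ∂P ≤ L := by
      refine le_trans ?_ (hL _ ⟨P, hP, rfl⟩)
      exact integral_mono_of_nonneg (.of_forall fun z => NNReal.coe_nonneg _) (hi P hP)
        (.of_forall fun z => hcnc n z.1 z.2)
    have hcl (a : ℝ) : |max (-(K : ℝ)) (min K a)| ≤ K :=
      abs_le.2 ⟨le_max_left _ _, max_le (by linarith) (min_le_left _ _)⟩
    refine ⟨fun x => max (-(K : ℝ)) (min K (u (marks A n x) - f₂ x)),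
      fun y => max (-(K : ℝ)) (min K (v (marks E n y) - g₂ y)),
      measurable_const.max (measurable_const.min (hu.1.sub hf₂.1)),
      measurable_const.max (measurable_const.min (hv.1.sub hg₂.1)), fun x => hcl _, fun y => hcl _,
      fun x y => ?_, ?_⟩
    · have h1 := huv (marks A n x) (marks E n y)
      have h2 : markedSup q n (marks A n x) (marks E n y) ≤ c (x, y) := hcnc n x y
      have h3 := hle x y
      simp only [hcn]
      exact le_clamp_add_clamp (by linarith) (by linarith)
    · have h1 := integral_clamp_sub_le hf₂ hu (fun x => hu0 _) hK
      have h2 := integral_clamp_sub_le hg₂ hv (fun x => hv0 _) hK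
      linarith
  classical
  have hNae : ∀ᵐ x ∂μ, x ∉ N := measure_eq_zero_iff_ae_notMem.1 hN0
  have hMae : ∀ᵐ y ∂ν, y ∉ M ∪ Bᶜ := measure_eq_zero_iff_ae_notMem.1
    (measure_union_null hM0 ((prob_compl_eq_zero_iff hB).2 hB1))
  -- On the exceptional sets the bounded part is set to `K`. The other bounded part is at least
  -- `-K`, so the sum is still at least `f₂ + g₂ ≥ c`.
  set f : X → ℝ := fun x => f₂ x + if x ∈ N then (K : ℝ) else h x with hf
  set g : Y → ℝ := fun y => g₂ y + if y ∈ M ∪ Bᶜ then (K : ℝ) else k y with hg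
  have hfe : f =ᵐ[μ] fun x => f₂ x + h x := by
    filter_upwards [hNae] with x hx
    simp only [hf, if_neg hx]
  have hge : g =ᵐ[ν] fun y => g₂ y + k y := by
    filter_upwards [hMae] with y hy
    simp only [hg, if_neg hy]
  have hhi : Integrable h μ := .of_bound hh.aestronglyMeasurable K (hNae.mono hhK)
  have hki : Integrable k ν := .of_bound hk.aestronglyMeasurable K
    (hMae.mono fun y hy => hkK y fun h => hy (.inl h))
  refine ⟨_, ⟨f, g, ⟨hf₂.1.add (.ite hN measurable_const hh),
    (hf₂.2.add hhi).congr hfe.symm⟩, ⟨hg₂.1.add (.ite (hM.union hB.compl) measurable_const hk),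
    (hg₂.2.add hki).congr hge.symm⟩, fun x y => ?_, rfl⟩, ?_⟩
  · have hxy := hle x y
    by_cases hx : x ∈ N
    · have h1 : -(K : ℝ) ≤ if y ∈ M ∪ Bᶜ then (K : ℝ) else k y := by
        split_ifs with hy
        · linarith
        · exact (abs_le.1 (hkK y fun h => hy (.inl h))).1
      simp only [hf, hg, if_pos hx]
      linarith
    by_cases hy : y ∈ M ∪ Bᶜ
    · have := (abs_le.1 (hhK x hx)).1
      simp only [hf, hg, if_neg hx, if_pos hy]
      linarith
    have hdn (n : ℕ) : cn n x y ≤ f x + g y := by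
      have := hd x hx y (fun h => hy (.inl h)) n
      simp only [hf, hg, if_neg hx, if_neg hy]
      linarith
    -- Every level below `c (x, y)` is negative or exceeded by some rectangle `i`, which enters the
    -- maximum at stage `i + 1`.
    refine le_of_forall_lt fun a ha => ?_
    rcases lt_or_ge a 0 with ha0 | ha0
    · exact (ha0.trans_le (NNReal.coe_nonneg _)).trans_le (hdn 0)
    · obtain ⟨i, hxi, hyi, hai⟩ := hcq x y (not_not.1 fun h => hy (.inr h)) a ha0 ha
      exact (hai.trans_le (le_markedSup_marks hxi hyi)).trans_le (hdn (i + 1))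
  · rw [integral_congr_ae hfe, integral_congr_ae hge, integral_add hf₂.2 hhi,
      integral_add hg₂.2 hki]
    linarith

/-- `α* = β*` for costs bounded below. -/
theorem alphaStar_eq_betaStar {c : X × Y → ℝ} (hc : HasIntegrableBounds μ ν c)
    (hcx : ∀ y, Measurable fun x => c (x, y)) (hcy : ∀ x, Continuous fun y => c (x, y))
    (hν : IsSeparableMeasure ν) (hb : BddBelow (Set.range c)) :
    alphaStar μ ν c = betaStar μ ν c := by
  have hi : ∀ P ∈ couplings μ ν, Integrable c P := fun P hP =>
    integrable_of_mem_couplings hc hcx hcy hν hP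
  obtain ⟨htne, -, hune⟩ := values_nonempty hc
  obtain ⟨r₀, hr₀⟩ := hune
  obtain ⟨s₀, hs₀⟩ := htne
  refine le_antisymm (csSup_le ⟨s₀, hs₀⟩ fun s hs => le_csInf ⟨r₀, hr₀⟩ fun r hr =>
    transport_le_upperDual hi hr hs) ?_
  have hbdd : BddBelow (upperDualValues μ ν c) :=
    ⟨s₀, fun r hr => transport_le_upperDual hi hr hs₀⟩
  have hbdd' : BddAbove (transportValues μ ν c) :=
    ⟨r₀, fun s hs => transport_le_upperDual hi hr₀ hs⟩
  refine le_of_forall_pos_le_add fun ε hε => ?_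
  obtain ⟨b, hb⟩ := hb
  replace hb (z) : b ≤ c z := hb ⟨z, rfl⟩
  obtain ⟨-, f₂, -, g₂, -, hf₂, -, hg₂, -, hle⟩ := hc
  have := nonempty_of_isProbabilityMeasure μ
  obtain ⟨y₀⟩ := nonempty_of_isProbabilityMeasure ν
  have hfb : BddBelow (Set.range f₂) := ⟨b - g₂ y₀, by
    rintro _ ⟨x, rfl⟩
    have := hle x y₀
    have := hb (x, y₀)
    linarith⟩
  -- With `a = inf f₂`, both `f₂ - a` and `g₂ + (a - b)` are nonnegative, and their sum dominates `c
  -- - b`.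
  set a := ⨅ x, f₂ x
  have hab (y : Y) : b - g₂ y ≤ a := le_ciInf fun x => by
    have := hle x y
    have := hb (x, y)
    linarith
  obtain ⟨_, ⟨f, g, hf, hg, hfg, rfl⟩, hr⟩ := exists_upperDual_le_of_nonneg (μ := μ) (ν := ν)
    (c := fun z => c z - b) (f₂ := fun x => f₂ x - a) (g₂ := fun y => g₂ y + (a - b))
    (L := alphaStar μ ν c - b) (fun z => sub_nonneg.2 (hb z))
    ⟨hf₂.1.sub_const a, hf₂.2.sub (integrable_const a)⟩
    ⟨hg₂.1.add_const (a - b), hg₂.2.add (integrable_const (a - b))⟩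
    (fun x => sub_nonneg.2 (ciInf_le hfb x)) (fun y => by linarith [hab y])
    (fun x y => by linarith [hle x y]) (fun y => (hcx y).sub_const b)
    (fun x => (hcy x).sub continuous_const) hν
    (fun P hP => have := hP.1; (hi P hP).sub (integrable_const b))
    (by
      rintro _ ⟨P, hP, rfl⟩
      have := hP.1
      rw [integral_sub (hi P hP) (integrable_const b)]
      simpa [alphaStar] using le_csSup hbdd' ⟨P, hP, rfl⟩) hε
  have hmem : (∫ x, f x ∂μ) + (∫ y, g y ∂ν) + b ∈ upperDualValues μ ν c := by
    refine ⟨f, fun y => g y + b, hf, ⟨hg.1.add_const b, hg.2.add (integrable_const b)⟩,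
      fun x y => ?_, ?_⟩
    · have : c (x, y) - b ≤ f x + g y := hfg x y
      linarith
    · rw [integral_add hg.2 (integrable_const b)]
      simp [add_assoc]
  have := csInf_le hbdd hmem
  rw [betaStar]
  linarith

/-! ### Change of sign -/

theorem IsL1.neg {Ω : Type*} [MeasurableSpace Ω] {Q : Measure Ω} {φ : Ω → ℝ} (h : IsL1 Q φ) :
    IsL1 Q (-φ) :=
  ⟨h.1.neg, h.2.neg⟩

theorem HasIntegrableBounds.neg {X Y : Type*} [MeasurableSpace X] [MeasurableSpace Y]
    {μ : Measure X} {ν : Measure Y} {c : X × Y → ℝ} (hc : HasIntegrableBounds μ ν c) :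
    HasIntegrableBounds μ ν (-c) := by
  obtain ⟨f₁, f₂, g₁, g₂, hf₁, hf₂, hg₁, hg₂, h₁, h₂⟩ := hc
  refine ⟨-f₂, -f₁, -g₂, -g₁, hf₂.neg, hf₁.neg, hg₂.neg, hg₁.neg, fun x y => ?_, fun x y => ?_⟩
  · have := h₂ x y
    simp only [Pi.neg_apply]
    linarith
  · have := h₁ x y
    simp only [Pi.neg_apply]
    linarith

/-- The real infimum is defined as minus the supremum of the negated set, and `integral_neg` is
unconditional, so neither boundedness nor integrability is needed. -/
theorem alpha_eq_neg_alphaStar_neg {X Y : Type*} [MeasurableSpace X] [MeasurableSpace Y]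
    (μ : Measure X) (ν : Measure Y) (c : X × Y → ℝ) : alpha μ ν c = -alphaStar μ ν (-c) := by
  have h : transportValues μ ν c = -transportValues μ ν (-c) := by
    ext r
    simp [transportValues, integral_neg, neg_eq_iff_eq_neg]
  rw [alpha, alphaStar, h, Real.sInf_def, neg_neg]

theorem beta_eq_neg_betaStar_neg {X Y : Type*} [MeasurableSpace X] [MeasurableSpace Y]
    (μ : Measure X) (ν : Measure Y) (c : X × Y → ℝ) : beta μ ν c = -betaStar μ ν (-c) := by
  have h : lowerDualValues μ ν c = -upperDualValues μ ν (-c) := by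
    ext r
    constructor
    · rintro ⟨f, g, hf, hg, h, rfl⟩
      refine ⟨-f, -g, hf.neg, hg.neg, fun x y => ?_, ?_⟩
      · have := h x y
        simp only [Pi.neg_apply]
        linarith
      · simp only [Pi.neg_apply, integral_neg]
        ring
    · rintro ⟨f, g, hf, hg, h, hr⟩
      refine ⟨-f, -g, hf.neg, hg.neg, fun x y => ?_, ?_⟩
      · have := h x y
        simp only [Pi.neg_apply] at this ⊢
        linarith
      · simp only [Pi.neg_apply, integral_neg]
        linarith
  rw [beta, betaStar, h, Real.sInf_def, neg_neg]

end TransportDuality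

/-! ### The duality theorem -/

theorem theorem3p4 {X Y : Type*}
    [MetricSpace X] [MeasurableSpace X] [BorelSpace X]
    [MetricSpace Y] [MeasurableSpace Y] [BorelSpace Y]
    (μ : Measure X) [IsProbabilityMeasure μ] (ν : Measure Y) [IsProbabilityMeasure ν]
    (c : X × Y → ℝ)
    (hc : TransportDuality.HasIntegrableBounds μ ν c)
    (hcx : ∀ y : Y, Measurable fun x : X => c (x, y))
    (hcy : ∀ x : X, Continuous fun y : Y => c (x, y))
    (hν : TransportDuality.IsSeparableMeasure ν) :
    (∀ P ∈ TransportDuality.couplings μ ν, Integrable c P) ∧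
    (BddBelow (Set.range c) →
      TransportDuality.alphaStar μ ν c = TransportDuality.betaStar μ ν c) ∧
    (BddAbove (Set.range c) →
      TransportDuality.alpha μ ν c = TransportDuality.beta μ ν c) ∧
    (BddBelow (Set.range c) → BddAbove (Set.range c) →
      TransportDuality.alpha μ ν c = TransportDuality.beta μ ν c ∧
      TransportDuality.alphaStar μ ν c = TransportDuality.betaStar μ ν c) := by
  have hstar := TransportDuality.alphaStar_eq_betaStar hc hcx hcy hν
  have hlow (h : BddAbove (Set.range c)) :
      TransportDuality.alpha μ ν c = TransportDuality.beta μ ν c := by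
    rw [TransportDuality.alpha_eq_neg_alphaStar_neg, TransportDuality.beta_eq_neg_betaStar_neg,
      TransportDuality.alphaStar_eq_betaStar hc.neg (fun y => (hcx y).neg) (fun x => (hcy x).neg) hν]
    obtain ⟨b, hb⟩ := h
    exact ⟨-b, by rintro _ ⟨z, rfl⟩; exact neg_le_neg (hb ⟨z, rfl⟩)⟩
  exact ⟨fun P hP => TransportDuality.integrable_of_mem_couplings hc hcx hcy hν hP, hstar, hlow,
    fun h h' => ⟨hlow h', hstar h⟩⟩
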